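/- Let $p=\sum_{J\subseteq[n]} a_J\prod_{j\in J}x_j\in\mathbb{R}[x_1,\dots,x_n]$ be a multiaffine polynomial that is homogeneous of degree $k$, and suppose that $p$ is stable, i.e. $p(z_1,\dots,z_n)\neq 0$ whenever all $z_i\in\mathbb{C}$ have positive imaginary part. Let $P=\Phi(p)$ be its minor lift, the polynomial $P(X)=\sum_{J\subseteq[n]} a_J\det(X_J)$ on the space of real symmetric $n\times n$ matrices, where $X_J$ is the principal submatrix of $X$ indexed by $J$. Then: 1. $P$ is hyperbolic with respect to the identity matrix $I$: it is homogeneous, $P(I)\neq 0$, and for every real symmetric $n\times n$ matrix $V$ the univariate polynomial $t\mapsto P(V-tI)$ has only real roots. 2. The hyperbolicity cone $H(P)=\{V \text{ real symmetric}: \text{all roots of } t\mapsto P(V-tI) \text{ are nonnegative}\}$ contains the cone $\mathrm{PSD}_k$ of all $k$-locally PSD matrices, i.e. of all real symmetric $n\times n$ matrices $A$ such that $A_J$ is positive semidefinite for every $J\subseteq[n]$ with $|J|=k$. 3. $P$ is PSD-stable: $P(Z)\neq 0$ for every complex symmetric $n\times n$ matrix $Z$ whose imaginary part is positive definite. -/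

import Mathlib

noncomputable section

/-! ### Stable, multiaffine and hyperbolic polynomials -/

/-- A real polynomial is multiaffine if it is a linear combination of square-free monomials. -/
def IsMultiaffine {σ : Type*} (p : MvPolynomial σ ℝ) : Prop :=
  ∀ m ∈ p.support, ∀ i, m i ≤ 1

/-- A real polynomial is stable if it has no zero whose coordinates all lie in the open upper
half-plane. -/
def IsStable {σ : Type*} (p : MvPolynomial σ ℝ) : Prop :=
  ∀ z : σ → ℂ, (∀ i, 0 < (z i).im) → MvPolynomial.aeval z p ≠ 0

/-- `p` is hyperbolic with respect to `a`: it is homogeneous, `p(a) ≠ 0`, and for every real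
point `v` all complex roots `t` of `p(v - t a)` are real. -/
def IsHyperbolic {σ : Type*} (p : MvPolynomial σ ℝ) (a : σ → ℝ) : Prop :=
  (∃ d : ℕ, p.IsHomogeneous d) ∧
  MvPolynomial.eval a p ≠ 0 ∧
  ∀ (v : σ → ℝ) (t : ℂ),
    MvPolynomial.aeval (fun i => (v i : ℂ) - t * (a i : ℂ)) p = 0 → t.im = 0

/-- The hyperbolicity cone of `p` (meant for `p` hyperbolic with respect to `a`): the points `v`
such that `p(v - t a)` has only nonnegative roots. -/
def hyperbolicityCone {σ : Type*} (p : MvPolynomial σ ℝ) (a : σ → ℝ) : Set (σ → ℝ) :=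
  {v | ∀ t : ℝ, MvPolynomial.eval (fun i => v i - t * a i) p = 0 → 0 ≤ t}

/-! ### Polynomials on the space of symmetric matrices

The ring of polynomials on symmetric `n × n` matrices has one variable for each unordered pair
of indices, that is, for each element of `Sym2 (Fin n)`. -/

/-- The symmetric `n × n` matrices with entries in `R`. -/
abbrev SymMat (n : ℕ) (R : Type*) : Type _ :=
  {A : Matrix (Fin n) (Fin n) R // A.IsSymm}

/-- The coordinates of a symmetric matrix: the coordinate at the pair `s(i, j)` is the
`(i, j)` entry. -/
def SymMat.coord {n : ℕ} {R : Type*} (A : SymMat n R) : Sym2 (Fin n) → R :=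
  Sym2.lift ⟨fun i j => A.1 i j, fun i j => A.2.apply j i⟩

/-- The identity matrix as a symmetric matrix. -/
def SymMat.id (n : ℕ) : SymMat n ℝ := ⟨1, Matrix.isSymm_one⟩

/-- The generic symmetric matrix, whose `(i, j)` entry is the variable of the pair `s(i, j)`. -/
def genericSym (n : ℕ) : Matrix (Fin n) (Fin n) (MvPolynomial (Sym2 (Fin n)) ℝ) :=
  Matrix.of fun i j => MvPolynomial.X s(i, j)

/-- The principal submatrix `A_J`. -/
def principalSubmatrix {n : ℕ} {R : Type*} (A : Matrix (Fin n) (Fin n) R)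
    (J : Finset (Fin n)) : Matrix J J R :=
  A.submatrix (fun i => (i : Fin n)) (fun i => (i : Fin n))

/-- The minor lift of (a multiaffine polynomial) `p = ∑_J a_J x^J`, namely
`∑_J a_J det (X_J)`, where `X` is the generic symmetric matrix. -/
def minorLift {n : ℕ} (p : MvPolynomial (Fin n) ℝ) : MvPolynomial (Sym2 (Fin n)) ℝ :=
  ∑ J : Finset (Fin n),
    MvPolynomial.C (p.coeff (∑ i ∈ J, Finsupp.single i 1)) *
      (principalSubmatrix (genericSym n) J).det

/-- A polynomial on symmetric matrices is PSD-stable if it does not vanish at any complex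
symmetric matrix with positive definite imaginary part. -/
def IsPSDStable {n : ℕ} (P : MvPolynomial (Sym2 (Fin n)) ℝ) : Prop :=
  ∀ Z : SymMat n ℂ, (Z.1.map Complex.im).PosDef → MvPolynomial.aeval Z.coord P ≠ 0

/-- The cone of `k`-locally PSD matrices: the real symmetric matrices all of whose `k × k`
principal submatrices are positive semidefinite. -/
def locallyPSD (n k : ℕ) : Set (SymMat n ℝ) :=
  {A | ∀ J : Finset (Fin n), J.card = k → (principalSubmatrix A.1 J).PosSemidef}

/-- The hyperbolicity cone, with respect to the identity matrix, of a polynomial on symmetric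
matrices. -/
def symHyperbolicityCone {n : ℕ} (P : MvPolynomial (Sym2 (Fin n)) ℝ) : Set (SymMat n ℝ) :=
  {A | A.coord ∈ hyperbolicityCone P (SymMat.id n).coord}

end

/-!
Write `p = ∑_J a_J x^J`, so that `P(Z) = ∑_J a_J det Z_J`.

**PSD-stability.** Let `Z` be complex symmetric with positive definite imaginary part. For `u`, `v`
in `ℂⁿ`,
`det (Diag u + Diag v * Z) = ∑_S det Z_S ∏_{i ∈ S} v_i ∏_{i ∉ S} u_i`,
and for some `ε > 0` this does not vanish when every `(u_i : v_i)` is a point of the projective line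
that is infinite or satisfies `-ε < Im`. Multiplying by `p(x)` gives a form in the pairs of
variables `(1 : x_i)`, `(u_i : v_i)`, and `P(Z)` is obtained from it by contracting these pairs one
index at a time. Each contraction preserves nonvanishing (`add_ne_zero_of_bilinear_ne_zero`): a
bilinear form in `(1 : x)` and `(u : v)` defines the Möbius map sending `x` to minus its zero
`u / v`; the hypothesis says that this map sends the upper half-plane into `{ε ≤ Im}`, whereas a
vanishing contraction would make it an involution. The induction is `sum_diagonal_ne_zero`.

**Hyperbolicity.** For `t` with negative imaginary part, `V - tI` has positive definite imaginary
part; for positive imaginary part pass to `-(V - tI)` by homogeneity. Also `P(I) = i⁻ᵏ P(iI) ≠ 0`.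

**The hyperbolicity cone.** By homogeneity and stability `p` has no zero in the open positive
orthant, while `p(1_J) = a_J` when `#J = k`. Hence by the intermediate value theorem all `a_J` have
the sign of `p(1, …, 1)` (`coeff_mul_eval_one_nonneg`). If `A` is `k`-locally PSD and `t < 0`, all
`k × k` principal minors of `A - tI` are positive, so `P(A - tI) ≠ 0`.
-/

open Finset Matrix

/-! ### Multiaffine polynomials as sums over sets -/

/-- The exponent vector of the square-free monomial `∏ j ∈ J, X j`. -/
noncomputable def squarefreeExponent {σ : Type*} (J : Finset σ) : σ →₀ ℕ :=
  ∑ i ∈ J, Finsupp.single i 1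

lemma squarefreeExponent_apply {σ : Type*} [DecidableEq σ] (J : Finset σ) (i : σ) :
    squarefreeExponent J i = if i ∈ J then 1 else 0 := by
  simp [squarefreeExponent, Finsupp.finsetSum_apply, Finsupp.single_apply]

lemma squarefreeExponent_injective {σ : Type*} :
    Function.Injective (squarefreeExponent (σ := σ)) := by
  classical
  intro J K h
  ext i
  have := DFunLike.congr_fun h i
  simp only [squarefreeExponent_apply] at this
  by_cases h1 : i ∈ J <;> by_cases h2 : i ∈ K <;> simp_all

lemma degree_squarefreeExponent {σ : Type*} (J : Finset σ) :
    (squarefreeExponent J).degree = #J := by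
  simp [squarefreeExponent, map_sum]

lemma IsMultiaffine.eq_sum {σ : Type*} [Fintype σ] {p : MvPolynomial σ ℝ}
    (haff : IsMultiaffine p) :
    p = ∑ J : Finset σ, MvPolynomial.monomial (squarefreeExponent J)
      (p.coeff (squarefreeExponent J)) := by
  classical
  ext m
  simp only [MvPolynomial.coeff_sum, MvPolynomial.coeff_monomial]
  by_cases hm : ∃ J : Finset σ, squarefreeExponent J = m
  · obtain ⟨J, rfl⟩ := hm
    simp [squarefreeExponent_injective.eq_iff]
  · rw [Finset.sum_eq_zero fun J _ => if_neg fun h => hm ⟨J, h⟩]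
    by_contra h
    refine hm ⟨m.support, ?_⟩
    ext i
    have := haff m (MvPolynomial.mem_support_iff.mpr h) i
    rw [squarefreeExponent_apply]
    split_ifs with hi
    · have := Finsupp.mem_support_iff.mp hi
      omega
    · exact (Finsupp.notMem_support_iff.mp hi).symm

lemma IsMultiaffine.aeval_eq_sum {σ R : Type*} [Fintype σ] [CommRing R] [Algebra ℝ R]
    {p : MvPolynomial σ ℝ} (haff : IsMultiaffine p) (z : σ → R) :
    MvPolynomial.aeval z p =
      ∑ J : Finset σ, algebraMap ℝ R (p.coeff (squarefreeExponent J)) * ∏ j ∈ J, z j := by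
  classical
  conv_lhs => rw [haff.eq_sum]
  rw [map_sum]
  refine Finset.sum_congr rfl fun J _ => ?_
  rw [MvPolynomial.aeval_monomial, Finsupp.prod_fintype _ _ (by simp)]
  congr 1
  simp [squarefreeExponent_apply, pow_ite, Finset.prod_ite_mem]

/-! ### Contraction of pairs of variables -/

/-- The points `w₁ : w₂` of the projective line that are the point at infinity or lie in the
half-plane `-ε < Im w`, each in its normalized coordinates `(w, 1)` or `(1, 0)`. -/
def InExtendedHalfPlane (ε : ℝ) (w : ℂ × ℂ) : Prop :=
  (w.2 = 1 ∧ -ε < w.1.im) ∨ w = (1, 0)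

/-- Contraction in one pair of variables. Both parts of `InExtendedHalfPlane` are needed: the form
`w.2` has zero contraction and vanishes only at infinity, and `w.1 * x - w.2` has zero contraction
and no zeros with `0 < x.im` and `0 ≤ Im w`. -/
lemma add_ne_zero_of_bilinear_ne_zero {ε : ℝ} (hε : 0 < ε) {a b c d : ℂ}
    (h : ∀ x w, 0 < x.im → InExtendedHalfPlane ε w →
      a * w.1 + b * w.2 + (c * w.1 + d * w.2) * x ≠ 0) :
    a + d ≠ 0 := by
  intro had
  obtain rfl : d = -a := by linear_combination had
  have hden : ∀ x : ℂ, 0 < x.im → a + c * x ≠ 0 := fun x hx => by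
    simpa using h x (1, 0) hx (Or.inr rfl)
  -- The Möbius map `x ↦ (b - a x) / (a + c x)` sends the upper half-plane into `{ε ≤ Im}`.
  have him : ∀ x : ℂ, 0 < x.im → ε ≤ ((b - a * x) / (a + c * x)).im := fun x hx => by
    by_contra! hlt
    refine h x (-((b - a * x) / (a + c * x)), 1) hx (Or.inl ⟨rfl, ?_⟩) ?_
    · simpa using hlt
    · linear_combination -(div_mul_cancel₀ (b - a * x) (hden x hx))
  -- It is an involution, which is absurd at a point of imaginary part `ε / 2`.
  have hx : 0 < ((ε / 2 : ℝ) * Complex.I).im := by simpa using hε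
  set x : ℂ := (ε / 2 : ℝ) * Complex.I with hxdef
  have hy := him x hx
  set y := (b - a * x) / (a + c * x) with hydef
  have hy0 : 0 < y.im := hε.trans_le hy
  have hxy : (b - a * y) / (a + c * y) = x := by
    rw [div_eq_iff (hden y hy0)]
    linear_combination -(div_mul_cancel₀ (b - a * x) (hden x hx))
  have := him y hy0
  rw [hxy] at this
  simp [hxdef] at this
  linarith

/-- Contraction of all pairs of variables. The coefficients `f J S` are arbitrary, not products,
since the product form is lost after the first contraction. -/
lemma sum_diagonal_ne_zero {ι : Type*} [DecidableEq ι] {ε : ℝ} (hε : 0 < ε) (T : Finset ι)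
    (f : Finset ι → Finset ι → ℂ)
    (hf : ∀ (x : ι → ℂ) (w : ι → ℂ × ℂ), (∀ i, 0 < (x i).im) →
      (∀ i, InExtendedHalfPlane ε (w i)) →
      ∑ J ∈ T.powerset, ∑ S ∈ T.powerset,
        f J S * (∏ j ∈ J, x j) * ((∏ i ∈ S, (w i).2) * ∏ i ∈ T \ S, (w i).1) ≠ 0) :
    ∑ J ∈ T.powerset, f J J ≠ 0 := by
  induction T using Finset.induction_on generalizing f with
  | empty => simpa using hf (fun _ => Complex.I) (fun _ => (1, 0)) (by simp) (fun _ => Or.inr rfl)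
  | insert i T hi ih =>
    rw [Finset.sum_powerset_insert hi, ← Finset.sum_add_distrib]
    refine ih (fun J S => f J S + f (insert i J) (insert i S)) fun x w hx hw => ?_
    let m (J S : Finset ι) : ℂ :=
      (∏ j ∈ J, x j) * ((∏ i ∈ S, (w i).2) * ∏ i ∈ T \ S, (w i).1)
    have key := add_ne_zero_of_bilinear_ne_zero hε
      (a := ∑ J ∈ T.powerset, ∑ S ∈ T.powerset, f J S * m J S)
      (b := ∑ J ∈ T.powerset, ∑ S ∈ T.powerset, f J (insert i S) * m J S)
      (c := ∑ J ∈ T.powerset, ∑ S ∈ T.powerset, f (insert i J) S * m J S)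
      (d := ∑ J ∈ T.powerset, ∑ S ∈ T.powerset, f (insert i J) (insert i S) * m J S) ?_
    · convert key using 1
      simp only [← Finset.sum_add_distrib]
      refine Finset.sum_congr rfl fun J _ => Finset.sum_congr rfl fun S _ => ?_
      simp only [m]
      ring
    intro x' w' hx' hw'
    convert hf (Function.update x i x') (Function.update w i w') ?_ ?_ using 1
    · rw [Finset.sum_powerset_insert hi]
      simp only [Finset.sum_powerset_insert hi, Finset.sum_mul,
        ← Finset.sum_add_distrib]
      refine Finset.sum_congr rfl fun J hJ => Finset.sum_congr rfl fun S hS => ?_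
      have hiJ : i ∉ J := fun h => hi (Finset.mem_powerset.mp hJ h)
      have hiS : i ∉ S := fun h => hi (Finset.mem_powerset.mp hS h)
      have hne : ∀ {K : Finset ι}, i ∉ K → ∀ j ∈ K, j ≠ i := fun hK j hj hji => hK (hji ▸ hj)
      have hx1 : ∏ j ∈ J, Function.update x i x' j = ∏ j ∈ J, x j :=
        Finset.prod_congr rfl fun j hj => by rw [Function.update_of_ne (hne hiJ j hj)]
      have hw1 : ∏ j ∈ S, (Function.update w i w' j).2 = ∏ j ∈ S, (w j).2 :=
        Finset.prod_congr rfl fun j hj => by rw [Function.update_of_ne (hne hiS j hj)]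
      have hiTS : i ∉ T \ S := fun h => hi (Finset.mem_sdiff.mp h).1
      have hw2 : ∏ j ∈ T \ S, (Function.update w i w' j).1 = ∏ j ∈ T \ S, (w j).1 :=
        Finset.prod_congr rfl fun j hj => by rw [Function.update_of_ne (hne hiTS j hj)]
      have hd1 : insert i T \ S = insert i (T \ S) := Finset.insert_sdiff_of_notMem _ hiS
      have hd2 : insert i T \ insert i S = T \ S := by
        rw [Finset.insert_sdiff_insert, Finset.sdiff_insert_of_notMem hi]
      rw [hd1, hd2, Finset.prod_insert hiTS, Finset.prod_insert hiJ, Finset.prod_insert hiS, hx1,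
        hw1, hw2]
      simp only [Function.update_self, m]
      ring
    · intro j
      by_cases h : j = i
      · subst h; simpa using hx'
      · simpa [h] using hx j
    · intro j
      by_cases h : j = i
      · subst h; simpa using hw'
      · simpa [h] using hw j

/-! ### Determinants and positive definite imaginary parts -/

lemma det_diagonal_add_diagonal_mul {ι R : Type*} [Fintype ι] [DecidableEq ι] [CommRing R]
    (u v : ι → R) (M : Matrix ι ι R) :
    (diagonal u + diagonal v * M).det =
      ∑ S : Finset ι, (M.submatrix (fun i : S => (i : ι)) (fun i : S => (i : ι))).det *
        ((∏ i ∈ S, v i) * ∏ i ∈ univ \ S, u i) := by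
  let D := (detRowAlternating : (ι → R) [⋀^ι]→ₗ[R] R)
  have hrows : (diagonal u + diagonal v * M).det =
      D ((fun i => v i • M i) + fun i => u i • (1 : Matrix ι ι R) i) := by
    change D _ = D _
    congr 1
    ext i j
    simp [diagonal_apply, Matrix.one_apply, add_comm]
  rw [hrows, D.map_add_univ]
  refine Finset.sum_congr rfl fun S _ => ?_
  have hS : S.piecewise (fun i => v i • M i) (fun i => u i • (1 : Matrix ι ι R) i) =
      fun i => (if i ∈ S then v i else u i) • S.piecewise M.row (1 : Matrix ι ι R).row i := by
    ext i j
    by_cases hi : i ∈ S <;> simp [hi]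
  rw [hS, D.map_smul_univ]
  rw [← det_piecewise_one_eq_submatrix_det M S, smul_eq_mul, mul_comm, Finset.prod_ite]
  congr 2
  · simp
  · congr 1; ext; simp

/-- For symmetric `Z = A + iB` and `c = α + iβ`, the imaginary part of `c* Z c` is
`αᵀ B α + βᵀ B β`. -/
lemma eq_zero_of_star_dotProduct_mulVec_eq_zero {ι : Type*} [Fintype ι] {Z : Matrix ι ι ℂ}
    (hZ : Z.IsSymm) (hpos : (Z.map Complex.im).PosDef) {c : ι → ℂ}
    (hc : star c ⬝ᵥ (Z *ᵥ c) = 0) : c = 0 := by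
  set B := Z.map Complex.im
  have him : (star c ⬝ᵥ (Z *ᵥ c)).im =
      (fun i => (c i).re) ⬝ᵥ (B *ᵥ fun i => (c i).re) +
        (fun i => (c i).im) ⬝ᵥ (B *ᵥ fun i => (c i).im) := by
    -- The contribution of the real part of `Z` is antisymmetric in `i` and `j`.
    have hanti : ∑ i, ∑ j, (Z i j).re * ((c i).re * (c j).im - (c i).im * (c j).re) = 0 := by
      have hswap : ∑ i, ∑ j, (Z i j).re * ((c i).re * (c j).im - (c i).im * (c j).re) =
          -∑ i, ∑ j, (Z i j).re * ((c i).re * (c j).im - (c i).im * (c j).re) := by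
        conv_lhs => rw [Finset.sum_comm]
        simp only [← Finset.sum_neg_distrib]
        refine Finset.sum_congr rfl fun i _ => Finset.sum_congr rfl fun j _ => ?_
        rw [hZ.apply i j]
        ring
      linarith
    rw [← add_zero (_ + _), ← hanti]
    simp only [dotProduct, mulVec, Finset.mul_sum, ← Finset.sum_add_distrib, Complex.im_sum]
    refine Finset.sum_congr rfl fun i _ => Finset.sum_congr rfl fun j _ => ?_
    simp [B]
    ring
  have hre0 : (fun i => (c i).re) = 0 := by
    by_contra hne
    have h1 := hpos.dotProduct_mulVec_pos hne
    have h2 := hpos.posSemidef.dotProduct_mulVec_nonneg (fun i => (c i).im)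
    simp only [star_trivial] at h1 h2
    rw [hc, Complex.zero_im] at him
    linarith
  have him0 : (fun i => (c i).im) = 0 := by
    by_contra hne
    have h1 := hpos.dotProduct_mulVec_pos hne
    have h2 := hpos.posSemidef.dotProduct_mulVec_nonneg (fun i => (c i).re)
    simp only [star_trivial] at h1 h2
    rw [hc, Complex.zero_im] at him
    linarith
  ext i
  exact Complex.ext (congrFun hre0 i) (congrFun him0 i)

lemma Matrix.PosDef.exists_sub_smul_one_posDef {ι : Type*} [Fintype ι] [DecidableEq ι]
    {B : Matrix ι ι ℝ} (hB : B.PosDef) : ∃ ε : ℝ, 0 < ε ∧ (B - ε • (1 : Matrix ι ι ℝ)).PosDef := by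
  obtain ⟨ε, hε, hlt⟩ : ∃ ε : ℝ, 0 < ε ∧ ∀ i, ε < hB.1.eigenvalues i := by
    obtain ⟨ε, hε, h⟩ := Pi.exists_forall_pos_add_lt (x := fun _ : ι => (0 : ℝ))
      (y := hB.1.eigenvalues) fun i => hB.eigenvalues_pos i
    exact ⟨ε, hε, fun i => by simpa using h i⟩
  refine ⟨ε, hε, ?_⟩
  have : B - ε • (1 : Matrix ι ι ℝ) = Unitary.conjStarAlgAut ℝ _ hB.1.eigenvectorUnitary
      (diagonal fun i => hB.1.eigenvalues i - ε) := by
    have hdiag : (diagonal fun i => hB.1.eigenvalues i - ε) =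
        diagonal hB.1.eigenvalues - ε • (1 : Matrix ι ι ℝ) := by
      rw [← diagonal_one, ← diagonal_smul, diagonal_sub]
      congr 1
      ext i
      simp
    rw [hdiag, map_sub, map_smul, map_one]
    conv_lhs => rw [hB.1.spectral_theorem]
    rfl
  rw [this, Unitary.conjStarAlgAut_apply]
  exact (Unitary.isUnit_coe.posDef_star_right_conjugate_iff).mpr
    (PosDef.diagonal fun i => sub_pos.mpr (hlt i))

lemma det_diagonal_add_diagonal_mul_ne_zero {ι : Type*} [Fintype ι] [DecidableEq ι]
    {Z : Matrix ι ι ℂ} (hZ : Z.IsSymm) {ε : ℝ} (hε : 0 < ε)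
    (hpos : (Z.map Complex.im - ε • (1 : Matrix ι ι ℝ)).PosDef) {w : ι → ℂ × ℂ}
    (hw : ∀ i, InExtendedHalfPlane ε (w i)) :
    (diagonal (fun i => (w i).1) + diagonal (fun i => (w i).2) * Z).det ≠ 0 := by
  intro hdet
  obtain ⟨c, hc0, hc⟩ := exists_mulVec_eq_zero_iff.mpr hdet
  have hrow : ∀ i, (w i).1 * c i + (w i).2 * (Z *ᵥ c) i = 0 := fun i => by
    have := congrFun hc i
    rwa [add_mulVec, ← mulVec_mulVec, Pi.add_apply, mulVec_diagonal, mulVec_diagonal] at this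
  -- A kernel vector `c` vanishes at the indices where `w i` is infinite, so it is isotropic for
  -- `Z + diagonal u`, where `u` is extended by zero to these indices.
  let u : ι → ℂ := fun i => if (w i).2 = 0 then 0 else (w i).1
  have hsymm : (Z + diagonal u).IsSymm := hZ.add (isSymm_diagonal u)
  have hu : (Z + diagonal u).map Complex.im = (Z.map Complex.im - ε • (1 : Matrix ι ι ℝ)) +
      diagonal fun i => ε + (u i).im := by
    ext i j
    by_cases hij : i = j
    · subst hij; simp; ring
    · simp [hij]
  refine hc0 (eq_zero_of_star_dotProduct_mulVec_eq_zero hsymm (hu ▸ hpos.add_posSemidef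
    (PosSemidef.diagonal fun i => ?_)) ?_)
  · rcases hw i with ⟨h2, h1⟩ | h
    · have : u i = (w i).1 := by simp [u, h2]
      rw [this]
      exact (neg_lt_iff_pos_add'.mp h1).le
    · have : u i = 0 := by simp [u, h]
      simpa [this] using hε.le
  · refine Finset.sum_eq_zero fun i _ => ?_
    rw [add_mulVec, Pi.add_apply, mulVec_diagonal, Pi.star_apply]
    rcases hw i with ⟨h2, h1⟩ | h
    · have : u i = (w i).1 := by simp [u, h2]
      have hi := hrow i
      rw [h2, one_mul] at hi
      rw [this, add_comm, hi, mul_zero]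
    · have hi := hrow i
      simp only [h, one_mul, zero_mul, add_zero] at hi
      simp [hi]

lemma sum_mul_det_ne_zero {ι : Type*} [Fintype ι] [DecidableEq ι] {a : Finset ι → ℂ}
    (ha : ∀ x : ι → ℂ, (∀ i, 0 < (x i).im) → ∑ J, a J * ∏ j ∈ J, x j ≠ 0)
    {Z : Matrix ι ι ℂ} (hZ : Z.IsSymm) (hpos : (Z.map Complex.im).PosDef) :
    ∑ J : Finset ι,
      a J * (Z.submatrix (fun i : J => (i : ι)) (fun i : J => (i : ι))).det ≠ 0 := by
  obtain ⟨ε, hε, hposε⟩ := hpos.exists_sub_smul_one_posDef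
  have := sum_diagonal_ne_zero hε univ
    (fun J S => a J * (Z.submatrix (fun i : S => (i : ι)) (fun i : S => (i : ι))).det)
    fun x w hx hw => ?_
  · simpa using this
  · have hprod := mul_ne_zero (ha x hx) (det_diagonal_add_diagonal_mul_ne_zero hZ hε hposε hw)
    rw [det_diagonal_add_diagonal_mul, Finset.sum_mul_sum] at hprod
    simp only [Finset.powerset_univ]
    refine (Finset.sum_congr rfl fun J _ => Finset.sum_congr rfl fun S _ => ?_).trans_ne hprod
    ring

/-! ### The minor lift -/

/-- The symmetric matrix whose coordinate at the pair `s(i, j)` is `z s(i, j)`; this inverts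
`SymMat.coord`. -/
def symMatOfCoord {n : ℕ} {R : Type*} (z : Sym2 (Fin n) → R) : SymMat n R :=
  ⟨Matrix.of fun i j => z s(i, j), by ext i j; simp [Sym2.eq_swap]⟩

lemma coord_symMatOfCoord {n : ℕ} {R : Type*} (z : Sym2 (Fin n) → R) :
    (symMatOfCoord z).coord = z := by
  ext q
  induction q with
  | _ i j => rfl

lemma aeval_coord_minorLift {n : ℕ} {R : Type*} [CommRing R] [Algebra ℝ R]
    (p : MvPolynomial (Fin n) ℝ) (A : SymMat n R) :
    MvPolynomial.aeval A.coord (minorLift p) =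
      ∑ J : Finset (Fin n), algebraMap ℝ R (p.coeff (squarefreeExponent J)) *
        (principalSubmatrix A.1 J).det := by
  rw [minorLift, map_sum]
  refine Finset.sum_congr rfl fun J _ => ?_
  rw [map_mul, MvPolynomial.aeval_C, AlgHom.map_det]
  congr 2
  ext i j
  simp [principalSubmatrix, genericSym, SymMat.coord]

lemma eval_coord_minorLift {n : ℕ} (p : MvPolynomial (Fin n) ℝ) (A : SymMat n ℝ) :
    MvPolynomial.eval A.coord (minorLift p) =
      ∑ J : Finset (Fin n), p.coeff (squarefreeExponent J) * (principalSubmatrix A.1 J).det := by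
  simpa [MvPolynomial.aeval_eq_eval] using aeval_coord_minorLift p A

lemma isPSDStable_minorLift {n : ℕ} {p : MvPolynomial (Fin n) ℝ} (haff : IsMultiaffine p)
    (hstable : IsStable p) : IsPSDStable (minorLift p) := by
  intro Z hZ
  rw [aeval_coord_minorLift]
  refine sum_mul_det_ne_zero (fun x hx => ?_) Z.2 hZ
  rw [← haff.aeval_eq_sum]
  exact hstable x hx

lemma MvPolynomial.IsHomogeneous.coeff_squarefreeExponent {σ : Type*} {p : MvPolynomial σ ℝ}
    {k : ℕ} (hhom : p.IsHomogeneous k) {J : Finset σ} (hJ : #J ≠ k) :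
    p.coeff (squarefreeExponent J) = 0 :=
  hhom.coeff_eq_zero (by rwa [degree_squarefreeExponent])

lemma isHomogeneous_minorLift {n k : ℕ} {p : MvPolynomial (Fin n) ℝ}
    (hhom : p.IsHomogeneous k) : (minorLift p).IsHomogeneous k := by
  refine MvPolynomial.IsHomogeneous.sum _ _ _ fun J _ => ?_
  by_cases hJ : #J = k
  · refine MvPolynomial.IsHomogeneous.C_mul ?_ _
    rw [det_apply]
    refine MvPolynomial.IsHomogeneous.sum _ _ _ fun τ _ => ?_
    have hprod : (∏ i, principalSubmatrix (genericSym n) J (τ i) i).IsHomogeneous k := by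
      convert MvPolynomial.IsHomogeneous.prod univ
        (fun i => principalSubmatrix (genericSym n) J (τ i) i) (fun _ => 1)
        (fun i _ => MvPolynomial.isHomogeneous_X _ _) using 1
      simp [hJ]
    rcases Int.units_eq_one_or (Equiv.Perm.sign τ) with h | h <;> rw [h]
    · simpa using hprod
    · simpa using hprod.neg
  · have h0 : p.coeff (∑ i ∈ J, Finsupp.single i 1) = 0 := hhom.coeff_squarefreeExponent hJ
    rw [h0]
    simpa using MvPolynomial.isHomogeneous_zero _ _ _

lemma MvPolynomial.IsHomogeneous.aeval_smul {σ R : Type*} [Finite σ] [CommRing R] [Algebra ℝ R]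
    {p : MvPolynomial σ ℝ} {k : ℕ} (hhom : p.IsHomogeneous k) (c : R) (z : σ → R) :
    MvPolynomial.aeval (fun i => c * z i) p = c ^ k * MvPolynomial.aeval z p := by
  have := Fintype.ofFinite σ
  simp only [MvPolynomial.aeval_def, MvPolynomial.eval₂_eq', Finset.mul_sum]
  refine Finset.sum_congr rfl fun m hm => ?_
  have hk : ∑ i, m i = k := by
    rw [← hhom (MvPolynomial.mem_support_iff.mp hm), Finsupp.weight_apply,
      Finsupp.sum_fintype _ _ (by simp)]
    simp
  simp only [mul_pow, Finset.prod_mul_distrib, Finset.prod_pow_eq_pow_sum, hk]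
  ring

/-! ### Hyperbolicity and the hyperbolicity cone -/

lemma IsPSDStable.isHyperbolic {n k : ℕ} {P : MvPolynomial (Sym2 (Fin n)) ℝ}
    (hP : IsPSDStable P) (hhom : P.IsHomogeneous k) : IsHyperbolic P (SymMat.id n).coord := by
  have hstab (z : Sym2 (Fin n) → ℂ) (s : ℝ) (hs : 0 < s)
      (hz : ∀ q, (z q).im = s * (SymMat.id n).coord q) : MvPolynomial.aeval z P ≠ 0 := by
    rw [← coord_symMatOfCoord z]
    refine hP _ ?_
    have : (symMatOfCoord z).1.map Complex.im = s • (1 : Matrix (Fin n) (Fin n) ℝ) := by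
      ext i j
      exact hz s(i, j)
    rw [this]
    exact PosDef.one.smul hs
  refine ⟨⟨k, hhom⟩, fun h0 => ?_, fun v t ht => ?_⟩
  · refine hstab (fun q => Complex.I * ((SymMat.id n).coord q : ℂ)) 1 one_pos (by simp) ?_
    rw [hhom.aeval_smul]
    have : MvPolynomial.aeval (fun q => ((SymMat.id n).coord q : ℂ)) P =
        ((MvPolynomial.eval (SymMat.id n).coord P : ℝ) : ℂ) := by
      have := MvPolynomial.aeval_algebraMap_apply ℂ (SymMat.id n).coord P
      rwa [MvPolynomial.aeval_eq_eval] at this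
    rw [this, h0]
    simp
  · rcases lt_trichotomy t.im 0 with hlt | heq | hgt
    · exact absurd ht (hstab _ (-t.im) (by linarith) (by simp))
    · exact heq
    · refine absurd ?_ (hstab (fun q => -1 * ((v q : ℂ) - t * ((SymMat.id n).coord q : ℂ))) t.im
        hgt (by simp))
      rw [hhom.aeval_smul, ht, mul_zero]

lemma eval_ne_zero_of_pos {σ : Type*} [Finite σ] {p : MvPolynomial σ ℝ} {k : ℕ}
    (hhom : p.IsHomogeneous k) (hstable : IsStable p) {x : σ → ℝ} (hx : ∀ i, 0 < x i) :
    MvPolynomial.eval x p ≠ 0 := by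
  intro h0
  refine hstable (fun i => Complex.I * (x i : ℂ)) (by simpa using hx) ?_
  have : MvPolynomial.aeval (fun i => (x i : ℂ)) p = ((MvPolynomial.eval x p : ℝ) : ℂ) := by
    have := MvPolynomial.aeval_algebraMap_apply ℂ x p
    rwa [MvPolynomial.aeval_eq_eval] at this
  rw [hhom.aeval_smul, this, h0]
  simp

/-- The coefficients of a homogeneous stable multiaffine polynomial all have the same sign. -/
lemma coeff_mul_eval_one_nonneg {σ : Type*} [Fintype σ] {p : MvPolynomial σ ℝ} {k : ℕ}
    (hhom : p.IsHomogeneous k) (haff : IsMultiaffine p) (hstable : IsStable p) (J : Finset σ) :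
    0 ≤ p.coeff (squarefreeExponent J) * MvPolynomial.eval (fun _ => 1) p := by
  classical
  by_cases hJ : #J = k
  swap
  · rw [hhom.coeff_squarefreeExponent hJ, zero_mul]
  -- The restriction of `p` to the segment from the indicator vector of `J` to the all-ones vector.
  let g : ℝ → ℝ := fun t => MvPolynomial.eval (fun i => if i ∈ J then 1 else t) p
  have hg0 : g 0 = p.coeff (squarefreeExponent J) := by
    have := haff.aeval_eq_sum (fun i => if i ∈ J then (1 : ℝ) else 0)
    rw [MvPolynomial.aeval_eq_eval] at this
    refine this.trans ((Finset.sum_eq_single J (fun K _ hK => ?_) (by simp)).trans ?_)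
    · by_cases hKk : #K = k
      · obtain ⟨i, hiK, hiJ⟩ : ∃ i ∈ K, i ∉ J := by
          by_contra! hsub
          exact hK (Finset.eq_of_subset_of_card_le hsub (by rw [hJ, hKk]))
        rw [Finset.prod_eq_zero hiK (by simp [hiJ]), mul_zero]
      · rw [hhom.coeff_squarefreeExponent hKk, map_zero, zero_mul]
    · rw [Finset.prod_congr rfl fun i hi => if_pos hi]
      simp
  have hg1 : g 1 = MvPolynomial.eval (fun _ => 1) p := by simp [g]
  have hcont : Continuous g := by
    refine (MvPolynomial.continuous_eval p).comp (continuous_pi fun i => ?_)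
    split_ifs <;> fun_prop
  have hpos : ∀ t, 0 < t → g t ≠ 0 := fun t ht =>
    eval_ne_zero_of_pos hhom hstable fun i => by split_ifs <;> simp [ht]
  rw [← hg0, ← hg1]
  by_contra! hneg
  have hg0ne : g 0 ≠ 0 := fun h => by simp [h] at hneg
  obtain ⟨t, ht, hgt⟩ : (0 : ℝ) ∈ g '' Set.uIcc 0 1 := by
    refine intermediate_value_uIcc hcont.continuousOn ?_
    rcases mul_neg_iff.mp hneg with h | h
    · exact Set.mem_uIcc.mpr (Or.inr ⟨h.2.le, h.1.le⟩)
    · exact Set.mem_uIcc.mpr (Or.inl ⟨h.1.le, h.2.le⟩)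
  rw [Set.uIcc_of_le zero_le_one] at ht
  rcases ht.1.eq_or_lt with h | h
  · exact hg0ne (h ▸ hgt)
  · exact hpos t h hgt

lemma locallyPSD_subset {n k : ℕ} {p : MvPolynomial (Fin n) ℝ}
    (hhom : p.IsHomogeneous k) (haff : IsMultiaffine p) (hstable : IsStable p) :
    locallyPSD n k ⊆ symHyperbolicityCone (minorLift p) := by
  intro A hA t ht
  by_contra! hneg
  let B : SymMat n ℝ := ⟨A.1 - t • 1, A.2.sub (isSymm_one.smul t)⟩
  have hB : (fun q => A.coord q - t * (SymMat.id n).coord q) = B.coord := by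
    ext q
    induction q with
    | _ i j => rfl
  rw [hB, eval_coord_minorLift] at ht
  have hdet : ∀ J : Finset (Fin n), #J = k → 0 < (principalSubmatrix B.1 J).det := by
    intro J hJ
    have : principalSubmatrix B.1 J = principalSubmatrix A.1 J + (-t) • (1 : Matrix J J ℝ) := by
      ext i j
      simp [principalSubmatrix, B, Matrix.one_apply, sub_eq_add_neg]
    rw [this]
    exact ((PosDef.one.smul (neg_pos.mpr hneg)).posSemidef_add (hA J hJ)).det_pos
  set s := MvPolynomial.eval (fun _ => (1 : ℝ)) p with hs
  have hs0 : s ≠ 0 := eval_ne_zero_of_pos hhom hstable fun _ => one_pos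
  have hsum : ∑ J : Finset (Fin n),
      p.coeff (squarefreeExponent J) * s * (principalSubmatrix B.1 J).det = 0 := by
    rw [← zero_mul s, ← ht, Finset.sum_mul]
    exact Finset.sum_congr rfl fun J _ => by ring
  have hterm : ∀ J : Finset (Fin n),
      0 ≤ p.coeff (squarefreeExponent J) * s * (principalSubmatrix B.1 J).det := by
    intro J
    by_cases hJ : #J = k
    · exact mul_nonneg (coeff_mul_eval_one_nonneg hhom haff hstable J) (hdet J hJ).le
    · simp [hhom.coeff_squarefreeExponent hJ]
  have hcoeff : ∀ J : Finset (Fin n), p.coeff (squarefreeExponent J) = 0 := by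
    intro J
    by_cases hJ : #J = k
    · have := (Finset.sum_eq_zero_iff_of_nonneg fun J _ => hterm J).mp hsum J (mem_univ J)
      simpa [hs0, (hdet J hJ).ne'] using this
    · exact hhom.coeff_squarefreeExponent hJ
  refine hs0 ?_
  rw [hs, haff.eq_sum]
  simp [hcoeff]

theorem theorem1 (n k : ℕ) (p : MvPolynomial (Fin n) ℝ)
    (hhom : p.IsHomogeneous k) (haff : IsMultiaffine p) (hstable : IsStable p) :
    IsHyperbolic (minorLift p) (SymMat.id n).coord ∧
      locallyPSD n k ⊆ symHyperbolicityCone (minorLift p) ∧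
      IsPSDStable (minorLift p) :=
  have hP := isPSDStable_minorLift haff hstable
  ⟨hP.isHyperbolic (isHomogeneous_minorLift hhom), locallyPSD_subset hhom haff hstable, hP⟩
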